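/- Let $\lambda,q\in\mathbb C$, $\nu\in\{0,\tfrac12\}$, and let $(c_n)_{n\ge 0}$ be complex numbers such that the series $y(x)=\sum_{n\ge 0}c_nx^{n+\nu}$ converges and satisfies the algebraic Mathieu equation $$4x(1-x)\,y''+2(1-2x)\,y'+(\lambda+2q-4qx)\,y=0$$ on some real interval $(0,r)$, $r>0$ (this is Mathieu's equation $\frac{d^2y}{dz^2}+(\lambda-2q\cos 2z)y=0$ with $x=\cos^2 z$). Write $(a)_i$ for the rising factorial, $I_0(z)=\sum_{l\ge0}\frac{(z/2)^{2l}}{(l!)^2}$ for the modified Bessel function, and, for $\eta\in\mathbb C$ and $t_l,u_l\in[0,1]$, $$w_{a,b}=\eta\prod_{l=a}^{b}t_lu_l\quad(a\le b),\qquad w_{a,b}=\eta\quad(a>b).$$ For $n\ge 1$ let $Y_n(\eta)$ be the $n$-fold nested double integral $$Y_n(\eta)=\prod_{k=0}^{n-1}\Bigg\{\int_0^1 dt_{n-k}\,t_{n-k}^{-\frac54+\frac12(n-k+\nu)}\int_0^1 du_{n-k}\,u_{n-k}^{-1+\frac12(n-k+\nu)}\,I_0\Big(2\sqrt{w_{n+1-k,n}(1-t_{n-k})(1-u_{n-k})}\Big)$$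 $$\qquad\times\Big(w_{n-k,n}^{-\frac12(n-1-k+\nu)}\big(w_{n-k,n}\partial_{w_{n-k,n}}\big)^2w_{n-k,n}^{\frac12(n-1-k+\nu)}-\tfrac1{4^2}(\lambda+2q)\Big)\Bigg\}\sum_{i=0}^\infty\frac{w_{1,n}^{\,i}}{(1+\frac\nu2)_i(\frac34+\frac\nu2)_i},$$ where the factors are composed from left to right (the factor $k=0$ is outermost), so that each operator acts on everything to its right, regarded as a function of the single variable $w_{n-k,n}$; at $w=0$ the operator $w^{-a}(w\partial_w)^2w^{a}$ is understood as its limit $w\to0$, that is, $f\mapsto a^2f(0)$. Then: 1. The base series $\sum_i \frac{w^i}{(1+\nu/2)_i(3/4+\nu/2)_i}$ converges for every $w\in\mathbb C$; every function to which one of the operators is applied, and every $Y_n$, is entire; and each of the double integrals converges absolutely, for every complex value of the outer variable $w_{n+1-k,n}$. 2. For every $x\in\mathbb C$ with $|x|<1$, with $\eta=\tfrac14qx^2$, the series $\sum_n c_nx^{n+\nu}$ and $\sum_{n\ge1}Y_n(\eta)x^n$ converge absolutely and $$y(x)=c_0x^\nu\Bigg\{\sum_{i=0}^\infty\frac{\eta^i}{(1+\frac\nu2)_i(\frac34+\frac\nu2)_i}+\sum_{n=1}^\infty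 Y_n(\eta)\,x^n\Bigg\}.$$ (Powers of $x$ are principal values.) -/

import Mathlib

open MeasureTheory

noncomputable section

namespace Mathieu

/-- The terms `c_n x^{n+ν}` of a Frobenius series (principal branch of the power). -/
def frobeniusTerm (ν : ℝ) (c : ℕ → ℂ) (x : ℂ) (n : ℕ) : ℂ :=
  c n * x ^ ((n : ℂ) + (ν : ℂ))

/-- The Frobenius series `y(x) = ∑ c_n x^{n+ν}`. -/
def frobeniusSum (ν : ℝ) (c : ℕ → ℂ) (x : ℂ) : ℂ :=
  ∑' n : ℕ, frobeniusTerm ν c x n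

/-- The algebraic Mathieu equation
`4x(1-x) y'' + 2(1-2x) y' + (lam + 2q - 4qx) y = 0` at the real point `x`,
for a complex-valued function `y` of a real variable. -/
def SatisfiesEquationAt (lam q : ℂ) (y : ℝ → ℂ) (x : ℝ) : Prop :=
  4 * (x : ℂ) * (1 - x) * deriv (deriv y) x + 2 * (1 - 2 * (x : ℂ)) * deriv y x
    + (lam + 2 * q - 4 * q * x) * y x = 0

/-- The series `∑ c_n x^{n+ν}` converges and solves the algebraic Mathieu equation on some
interval `(0, r)` with `r > 0`. -/
def IsFrobeniusSolution (lam q : ℂ) (ν : ℝ) (c : ℕ → ℂ) : Prop :=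
  ∃ r : ℝ, 0 < r ∧ ∀ x ∈ Set.Ioo (0 : ℝ) r,
    Summable (frobeniusTerm ν c x) ∧
      SatisfiesEquationAt lam q (fun s : ℝ => frobeniusSum ν c s) x

/-- The modified Bessel function of the first kind of order zero,
`I_0(z) = ∑ (z/2)^{2l} / (l!)^2`. -/
def besselI0 (z : ℂ) : ℂ :=
  ∑' l : ℕ, (z / 2) ^ (2 * l) / ((l.factorial : ℂ) * (l.factorial : ℂ))

/-- The terms `w^i / ((1+ν/2)_i (3/4+ν/2)_i)` of the base series, where `(a)_i` is the rising
factorial. -/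
def baseTerm (ν : ℝ) (w : ℂ) (i : ℕ) : ℂ :=
  1 / ((ascPochhammer ℂ i).eval (1 + (ν : ℂ) / 2)
    * (ascPochhammer ℂ i).eval (3 / 4 + (ν : ℂ) / 2)) * w ^ i

/-- The base series `∑ w^i / ((1+ν/2)_i (3/4+ν/2)_i)`. -/
def baseSeries (ν : ℝ) (w : ℂ) : ℂ :=
  ∑' i : ℕ, baseTerm ν w i

/-- The Euler operator `w ∂_w`. -/
def euler (f : ℂ → ℂ) (w : ℂ) : ℂ :=
  w * deriv f w

/-- The operator `w^{-a} (w ∂_w)^2 w^a`, applied to `f` and evaluated at `w₀`.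
For `w₀ ≠ 0` the constant factor `w₀^{-a}` is moved inside the derivatives and `w₀^{-a} w^a` is
written as the principal value of `(w / w₀)^a`, which is holomorphic near `w₀`; the result is the
one given by every branch of `w^a` near `w₀`.  At `w₀ = 0` it is the limit as `w₀ → 0`, which for
`f` holomorphic near `0` is `a^2 f(0)`. -/
def conjEulerSq (a : ℝ) (f : ℂ → ℂ) (w₀ : ℂ) : ℂ :=
  if w₀ = 0 then (a : ℂ) ^ 2 * f 0
  else euler (euler (fun w : ℂ => (w / w₀) ^ (a : ℂ) * f w)) w₀

/-- The operator `w^{-a} (w ∂_w)^2 w^a - (lam + 2q) / 4^2`. -/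
def mathieuOp (lam q : ℂ) (a : ℝ) (f : ℂ → ℂ) (w : ℂ) : ℂ :=
  conjEulerSq a f w - 1 / 4 ^ 2 * (lam + 2 * q) * f w

/-- The integrand of the `j`-th double integral, as a function of `t = t_j` and `u = u_j`:
`t^{-5/4+(j+ν)/2} u^{-1+(j+ν)/2} I_0(2 √(w (1-t)(1-u))) g(w t u)`.
Here `w` stands for `w_{j+1,n}`, so that `w t u` is `w_{j,n}`. (As `I_0` is even, the choice of the
square root does not matter.) -/
def integrand (ν : ℝ) (j : ℕ) (g : ℂ → ℂ) (w : ℂ) (t u : ℝ) : ℂ :=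
  ((t ^ (-(5 / 4 : ℝ) + ((j : ℝ) + ν) / 2) : ℝ) : ℂ)
    * ((u ^ (-(1 : ℝ) + ((j : ℝ) + ν) / 2) : ℝ) : ℂ)
    * besselI0 (2 * (w * (1 - (t : ℂ)) * (1 - (u : ℂ))) ^ (1 / 2 : ℂ))
    * g (w * t * u)

/-- The nested integrals.  `nested lam q ν j` is the block formed by the base series and the layers
`1, …, j`, as a function of the variable `w = w_{j+1,n}`; layer `j` is the operator
`w^{-a} (w ∂_w)^2 w^a - (lam + 2q) / 4^2` with `a = (j-1+ν)/2` in the variable `w_{j,n}`, followed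
by the double integral over `t_j` and `u_j`.
Because `w_{n+1,n} = η` and `w_{j,n} = w_{j+1,n} t_j u_j`, i.e. `w_{a,n} = η ∏_{l=a}^n t_l u_l`,
the `n`-fold nested integral is `nested lam q ν n η`. -/
def nested (lam q : ℂ) (ν : ℝ) : ℕ → ℂ → ℂ
  | 0 => baseSeries ν
  | j + 1 => fun w => ∫ t in (0 : ℝ)..1, ∫ u in (0 : ℝ)..1,
      integrand ν (j + 1) (mathieuOp lam q (((j : ℝ) + ν) / 2) (nested lam q ν j)) w t u

end Mathieu

end

open MeasureTheory

/-! Write `D` for `divisor` and `M` for `multiplier`. The equation amounts to `D(1) c(1) = M(0)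
c(0)` and `D(m+2) c(m+2) = M(m+1) c(m+1) + (q/4) c(m)`, so `c m` is `c 0` times a weighted sum over
lattice paths from `0` to `m` with steps of length 1 and 2. The `n`-fold integral collects the paths
with exactly `n` short steps: with `i` long ones they end at `m = n + 2i`, and `(q/4)^i x^(n+2i) =
η^i x^n`.

The base series has long steps only. In each layer the operator multiplies Taylor coefficients by
`M`, the weight of a short step, and the double integral inserts the long steps that follow. Indeed,
after expanding `I_0`, two beta integrals yield `(l!)^2` over products of `D`, the factorials
cancel, and `w^i` becomes `∑_l w^(i+l) / ∏_{k≤l} D` (`hasEntireSeries_integral`, `layerCoeff_succ`).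

Since `M(m)/D(m+1) → 1` and `1/D → 0`, the path sums are at most `K s^n t^i` for any `s > 1`, `t >
0` (`exists_norm_nestedCoeff_le`). Hence all blocks are entire, and for `|x| < 1` the double series
over `(n, i)` converges absolutely; grouping it by `n` or by `n + 2i` gives the two sides
(`exists_hasSum_nested_frobeniusCoeff`). -/

namespace Mathieu

/-! ### Entire power series and the Euler operator -/

/-- `f` is the sum of the everywhere convergent power series with coefficients `a`. -/
def HasEntireSeries (f : ℂ → ℂ) (a : ℕ → ℂ) : Prop :=
  ∀ w : ℂ, HasSum (fun i => a i * w ^ i) (f w)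

lemma HasEntireSeries.summable_norm {f : ℂ → ℂ} {a : ℕ → ℂ} (h : HasEntireSeries f a)
    {R : ℝ} (hR : 0 ≤ R) : Summable fun i => ‖a i‖ * R ^ i := by
  simpa [norm_mul, norm_pow, abs_of_nonneg hR] using (h (R : ℂ)).summable.norm

lemma HasEntireSeries.eq_tsum {f : ℂ → ℂ} {a : ℕ → ℂ} (h : HasEntireSeries f a) :
    f = fun w => ∑' i, a i * w ^ i :=
  funext fun w => (h w).tsum_eq.symm

lemma HasEntireSeries.differentiable {f : ℂ → ℂ} {a : ℕ → ℂ} (h : HasEntireSeries f a) :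
    Differentiable ℂ f := by
  intro w
  have hd := Complex.differentiableOn_tsum_of_summable_norm (U := Metric.ball (0 : ℂ) (‖w‖ + 1))
    (F := fun i z => a i * z ^ i) (h.summable_norm (by positivity : 0 ≤ ‖w‖ + 1))
    (fun i => by fun_prop) Metric.isOpen_ball (fun i z hz => by
      rw [norm_mul, norm_pow]
      gcongr
      simpa using (mem_ball_zero_iff.1 hz).le)
  rw [h.eq_tsum]
  exact hd.differentiableAt (Metric.isOpen_ball.mem_nhds (by simp))

lemma HasEntireSeries.apply_zero {f : ℂ → ℂ} {a : ℕ → ℂ} (h : HasEntireSeries f a) :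
    f 0 = a 0 := by
  refine (h 0).unique ?_
  simpa using hasSum_single (f := fun i => a i * (0 : ℂ) ^ i) 0 (fun i hi => by simp [hi])

lemma HasEntireSeries.add {f g : ℂ → ℂ} {a b : ℕ → ℂ} (hf : HasEntireSeries f a)
    (hg : HasEntireSeries g b) :
    HasEntireSeries (fun w => f w + g w) (fun i => a i + b i) := fun w => by
  simpa [add_mul] using (hf w).add (hg w)

lemma HasEntireSeries.const_mul {f : ℂ → ℂ} {a : ℕ → ℂ} (k : ℂ) (hf : HasEntireSeries f a) :
    HasEntireSeries (fun w => k * f w) (fun i => k * a i) := fun w => by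
  simpa [mul_assoc] using (hf w).mul_left k

lemma HasEntireSeries.euler {f : ℂ → ℂ} {a : ℕ → ℂ} (h : HasEntireSeries f a) :
    HasEntireSeries (euler f) (fun i => (i : ℂ) * a i) := by
  intro w
  have hd := Complex.hasSum_deriv_of_summable_norm (U := Metric.ball (0 : ℂ) (‖w‖ + 1))
    (F := fun i z => a i * z ^ i) (h.summable_norm (by positivity : 0 ≤ ‖w‖ + 1))
    (fun i => by fun_prop) Metric.isOpen_ball (fun i z hz => by
      rw [norm_mul, norm_pow]
      gcongr
      simpa using (mem_ball_zero_iff.1 hz).le) (show w ∈ _ by simp)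
  rw [← h.eq_tsum] at hd
  have hterm : (fun i : ℕ => (i : ℂ) * a i * w ^ i)
      = fun i => w * deriv (fun z => a i * z ^ i) w := by
    funext i
    rw [deriv_const_mul_field, deriv_pow_field]
    rcases i with _ | i
    · simp
    · push_cast [Nat.add_sub_cancel]
      ring
  show HasSum (fun i : ℕ => (i : ℂ) * a i * w ^ i) _
  rw [hterm]
  exact hd.mul_left w

/-- Moving `w^a` past `w∂` turns `w∂` into `w∂ + a`. The identity is needed at all `w` near `w₀`,
because a second derivative is taken afterwards. -/
lemma euler_div_cpow_mul {f : ℂ → ℂ} (hf : Differentiable ℂ f) (a : ℂ) {w₀ w : ℂ} (h₀ : w₀ ≠ 0)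
    (hw : w / w₀ ∈ Complex.slitPlane) :
    euler (fun z => (z / w₀) ^ a * f z) w = (w / w₀) ^ a * (a * f w + euler f w) := by
  have hne : w / w₀ ≠ 0 := Complex.slitPlane_ne_zero hw
  have hd : HasDerivAt (fun z : ℂ => (z / w₀) ^ a * f z)
      (a * (w / w₀) ^ (a - 1) * (1 / w₀) * f w + (w / w₀) ^ a * deriv f w) w :=
    (((hasDerivAt_id w).div_const w₀).cpow_const hw).mul (hf w).hasDerivAt
  rw [euler, hd.deriv, euler, Complex.cpow_sub _ _ hne, Complex.cpow_one]
  have hw0 : w ≠ 0 := by rintro rfl; simp at hne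
  field_simp

lemma HasEntireSeries.conjEulerSq {f : ℂ → ℂ} {b : ℕ → ℂ} (h : HasEntireSeries f b) (a : ℝ) :
    HasEntireSeries (conjEulerSq a f) (fun i => ((i : ℂ) + a) ^ 2 * b i) := by
  have h1 := h.euler.add (h.const_mul a)
  have h2 := h1.euler.add (h1.const_mul a)
  intro w₀
  rcases eq_or_ne w₀ 0 with rfl | h₀
  -- The prescribed value `a^2 f(0)` is the constant term of the claimed series.
  · have key : Mathieu.conjEulerSq a f 0 = ((0 : ℕ) + (a : ℂ)) ^ 2 * b 0 := by
      rw [Mathieu.conjEulerSq, if_pos rfl, h.apply_zero, Nat.cast_zero, zero_add]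
    rw [key]
    have := hasSum_single (f := fun i : ℕ => ((i : ℂ) + a) ^ 2 * b i * (0 : ℂ) ^ i) 0
      (fun i hi => by simp [hi])
    rwa [pow_zero, mul_one] at this
  · have hev : Mathieu.euler (fun w => (w / w₀) ^ (a : ℂ) * f w) =ᶠ[nhds w₀]
        fun w => (w / w₀) ^ (a : ℂ) * (Mathieu.euler f w + a * f w) := by
      have : ∀ᶠ w in nhds w₀, w / w₀ ∈ Complex.slitPlane :=
        (continuous_id.div_const w₀).continuousAt.eventually_mem
          (Complex.isOpen_slitPlane.mem_nhds (by simp [h₀]))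
      filter_upwards [this] with w hw
      rw [euler_div_cpow_mul h.differentiable a h₀ hw, add_comm]
    have key : Mathieu.conjEulerSq a f w₀ =
        Mathieu.euler (fun w => Mathieu.euler f w + a * f w) w₀
          + a * (Mathieu.euler f w₀ + a * f w₀) := by
      rw [Mathieu.conjEulerSq, if_neg h₀]
      have := euler_div_cpow_mul h1.differentiable (a : ℂ) (w := w₀) h₀ (by simp [h₀])
      rw [div_self h₀, Complex.one_cpow, one_mul, add_comm] at this
      rw [← this, Mathieu.euler, hev.deriv_eq, Mathieu.euler]
    rw [key]
    convert h2 w₀ using 2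
    ring

lemma HasEntireSeries.mathieuOp {f : ℂ → ℂ} {b : ℕ → ℂ} (h : HasEntireSeries f b)
    (lam q : ℂ) (a : ℝ) :
    HasEntireSeries (mathieuOp lam q a f)
      (fun i => (((i : ℂ) + a) ^ 2 - (lam + 2 * q) / 16) * b i) := by
  intro w
  convert (h.conjEulerSq a).add (h.const_mul (-(1 / 4 ^ 2 * (lam + 2 * q)))) w using 2
  · ring
  · rw [Mathieu.mathieuOp]; ring

/-! ### The Bessel kernel and beta integrals -/

/-- Only even powers of the square root occur, so its branch cut disappears. -/
lemma hasEntireSeries_besselI0 :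
    HasEntireSeries (fun w => besselI0 (2 * w ^ (1 / 2 : ℂ)))
      (fun l => 1 / ((l.factorial : ℂ) * (l.factorial : ℂ))) := by
  intro w
  have hterm : (fun l : ℕ => (2 * w ^ (1 / 2 : ℂ) / 2) ^ (2 * l) /
      ((l.factorial : ℂ) * (l.factorial : ℂ)))
      = fun l : ℕ => 1 / ((l.factorial : ℂ) * (l.factorial : ℂ)) * w ^ l := by
    funext l
    have : (w ^ (1 / 2 : ℂ)) ^ 2 = w := by simp
    rw [mul_div_cancel_left₀ _ (two_ne_zero), pow_mul, this]
    ring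
  simp only [besselI0, hterm]
  refine Summable.hasSum (Summable.of_norm_bounded (Real.summable_pow_div_factorial ‖w‖) ?_)
  intro l
  have h1 : (1 : ℝ) ≤ l.factorial := by exact_mod_cast l.factorial_pos
  rw [norm_mul, norm_pow, norm_div, norm_mul, norm_one, Complex.norm_natCast,
    div_eq_inv_mul (‖w‖ ^ l), one_div]
  gcongr
  nlinarith

/-- The kernel `t^{s-1} t^j (1-t)^l` of an Euler beta integral. -/
noncomputable def betaKernel (s : ℝ) (j l : ℕ) (t : ℝ) : ℂ :=
  ((t ^ (s - 1) : ℝ) : ℂ) * ((t : ℂ) ^ j * (1 - (t : ℂ)) ^ l)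

lemma integrableOn_rpow_sub_one {s : ℝ} (hs : 0 < s) :
    IntegrableOn (fun t : ℝ => t ^ (s - 1)) (Set.Ioo 0 1) :=
  (intervalIntegral.integrableOn_Ioo_rpow_iff zero_lt_one).2 (by linarith)

lemma integrableOn_betaKernel {s : ℝ} (hs : 0 < s) (j l : ℕ) :
    IntegrableOn (betaKernel s j l) (Set.Ioo 0 1) := by
  refine Integrable.mul_bdd (c := 1) (integrableOn_rpow_sub_one hs).ofReal
    (by fun_prop) ?_
  refine (ae_restrict_iff' measurableSet_Ioo).2 (Filter.Eventually.of_forall fun t ht => ?_)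
  rw [norm_mul, norm_pow, norm_pow, ← Complex.ofReal_one, ← Complex.ofReal_sub,
    Complex.norm_of_nonneg ht.1.le, Complex.norm_of_nonneg (sub_nonneg.2 ht.2.le)]
  exact mul_le_one₀ (pow_le_one₀ ht.1.le ht.2.le) (pow_nonneg (sub_nonneg.2 ht.2.le) _)
    (pow_le_one₀ (sub_nonneg.2 ht.2.le) (by linarith [ht.1]))

lemma integral_norm_betaKernel_le {s : ℝ} (hs : 0 < s) (j l : ℕ) :
    ∫ t in Set.Ioo (0 : ℝ) 1, ‖betaKernel s j l t‖ ≤ ∫ t in Set.Ioo (0 : ℝ) 1, t ^ (s - 1) := by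
  refine setIntegral_mono_on (integrableOn_betaKernel hs j l).norm (integrableOn_rpow_sub_one hs)
    measurableSet_Ioo fun t ht => ?_
  rw [betaKernel, norm_mul, norm_mul, norm_pow, norm_pow, ← Complex.ofReal_one,
    ← Complex.ofReal_sub, Complex.norm_of_nonneg ht.1.le,
    Complex.norm_of_nonneg (sub_nonneg.2 ht.2.le),
    Complex.norm_of_nonneg (Real.rpow_nonneg ht.1.le _)]
  exact mul_le_of_le_one_right (Real.rpow_nonneg ht.1.le _)
    (mul_le_one₀ (pow_le_one₀ ht.1.le ht.2.le) (pow_nonneg (sub_nonneg.2 ht.2.le) _)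
    (pow_le_one₀ (sub_nonneg.2 ht.2.le) (by linarith [ht.1])))

lemma integral_betaKernel {s : ℝ} (hs : 0 < s) (j l : ℕ) :
    ∫ t in Set.Ioo (0 : ℝ) 1, betaKernel s j l t
      = (l.factorial : ℂ) / ∏ k ∈ Finset.range (l + 1), ((s : ℂ) + (j + k : ℕ)) := by
  have h := Complex.betaIntegral_eval_nat_add_one_right (u := (s : ℂ) + j)
    (by simpa using (by positivity : 0 < s + j)) l
  rw [Complex.betaIntegral, intervalIntegral.integral_of_le zero_le_one,
    integral_Ioc_eq_integral_Ioo] at h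
  simp only [Nat.cast_add, ← add_assoc]
  rw [← h]
  refine setIntegral_congr_fun measurableSet_Ioo fun t ht => ?_
  have ht' : (t : ℂ) ≠ 0 := by exact_mod_cast ht.1.ne'
  rw [betaKernel, Complex.ofReal_cpow ht.1.le, add_sub_cancel_right, Complex.cpow_natCast,
    ← mul_assoc, ← Complex.cpow_natCast (t : ℂ) j, ← Complex.cpow_add _ _ ht']
  push_cast
  congr 3
  ring

/-! ### One layer acting on power series -/

/-- The coefficients produced by a layer from a power series with coefficients `g`, where `D` is
the sequence of divisors. -/
noncomputable def layerCoeff (D g : ℕ → ℂ) (i : ℕ) : ℂ :=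
  ∑ p ∈ Finset.HasAntidiagonal.antidiagonal i, g p.2 / ∏ k ∈ Finset.range (p.1 + 1), D (p.2 + k)

lemma layerCoeff_zero (D g : ℕ → ℂ) : layerCoeff D g 0 = g 0 / D 0 := by
  simp [layerCoeff]

/-- Every pair in the antidiagonal other than `(0, i + 1)` has `D (i + 1)` as the last factor of its
product; removing it leaves a pair for `i`. -/
lemma layerCoeff_succ (D g : ℕ → ℂ) (i : ℕ) :
    layerCoeff D g (i + 1) = (layerCoeff D g i + g (i + 1)) / D (i + 1) := by
  rw [layerCoeff, Finset.Nat.antidiagonal_succ, Finset.sum_cons, Finset.sum_map, add_div,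
    layerCoeff, Finset.sum_div, add_comm]
  congr 1
  · refine Finset.sum_congr rfl fun p hp => ?_
    rw [Finset.HasAntidiagonal.mem_antidiagonal] at hp
    show g p.2 / ∏ k ∈ Finset.range (p.1 + 1 + 1), D (p.2 + k) = _
    rw [Finset.prod_range_succ _ (p.1 + 1), div_mul_eq_div_div]
    congr 2
    omega
  · simp

section Layer

variable {ν : ℝ} {j : ℕ} {g : ℂ → ℂ} {b : ℕ → ℂ}

/-- The bound on `j` puts both exponents above `-1`; the other factors are continuous on the closed
square, hence bounded. -/
lemma integrableOn_integrand (hj : 1 / 4 < ((j : ℝ) + ν) / 2) (hg : Differentiable ℂ g) (w : ℂ) :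
    IntegrableOn (fun p : ℝ × ℝ => integrand ν j g w p.1 p.2)
      (Set.Ioo (0 : ℝ) 1 ×ˢ Set.Ioo (0 : ℝ) 1) := by
  have h1 : IntegrableOn (fun t : ℝ => ((t ^ (-(5 / 4 : ℝ) + ((j : ℝ) + ν) / 2) : ℝ) : ℂ))
      (Set.Ioo 0 1) :=
    ((intervalIntegral.integrableOn_Ioo_rpow_iff zero_lt_one).2 (by linarith)).ofReal
  have h2 : IntegrableOn (fun u : ℝ => ((u ^ (-(1 : ℝ) + ((j : ℝ) + ν) / 2) : ℝ) : ℂ))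
      (Set.Ioo 0 1) :=
    ((intervalIntegral.integrableOn_Ioo_rpow_iff zero_lt_one).2 (by linarith)).ofReal
  have hc : Continuous fun p : ℝ × ℝ =>
      besselI0 (2 * (w * (1 - (p.1 : ℂ)) * (1 - (p.2 : ℂ))) ^ (1 / 2 : ℂ)) * g (w * p.1 * p.2) := by
    have hb := hasEntireSeries_besselI0.differentiable.continuous
    exact (hb.comp (by fun_prop : Continuous fun p : ℝ × ℝ =>
      w * (1 - (p.1 : ℂ)) * (1 - (p.2 : ℂ)))).mul (hg.continuous.comp (by fun_prop))
  obtain ⟨C, hC⟩ := ((isCompact_Icc (a := (0 : ℝ)) (b := 1)).prod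
    (isCompact_Icc (a := (0 : ℝ)) (b := 1))).exists_bound_of_continuousOn hc.continuousOn
  have h12 := Integrable.mul_prod h1 h2
  rw [Measure.prod_restrict] at h12
  have := Integrable.mul_bdd (c := C) h12 hc.aestronglyMeasurable
    ((ae_restrict_iff' (measurableSet_Ioo.prod measurableSet_Ioo)).2
      (Filter.Eventually.of_forall fun p hp =>
        hC p ⟨Set.Ioo_subset_Icc_self hp.1, Set.Ioo_subset_Icc_self hp.2⟩))
  refine this.congr (Filter.Eventually.of_forall fun p => ?_)
  simp only [integrand]
  ring

lemma iteratedIntegral_eq_setIntegral_prod (hj : 1 / 4 < ((j : ℝ) + ν) / 2)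
    (hg : Differentiable ℂ g) (w : ℂ) :
    ∫ t in (0 : ℝ)..1, ∫ u in (0 : ℝ)..1, integrand ν j g w t u
      = ∫ p in Set.Ioo (0 : ℝ) 1 ×ˢ Set.Ioo (0 : ℝ) 1, integrand ν j g w p.1 p.2 := by
  have := setIntegral_prod (μ := (volume : Measure ℝ)) (ν := (volume : Measure ℝ)) _
    (integrableOn_integrand hj hg w)
  rw [Measure.volume_eq_prod, this]
  simp only [intervalIntegral.integral_of_le zero_le_one, integral_Ioc_eq_integral_Ioo]

lemma hasSum_mul_prod {ι κ : Type*} {f : ι → ℂ} {h : κ → ℂ} {x y : ℂ} (hf : HasSum f x)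
    (hh : HasSum h y) : HasSum (fun p : ι × κ => f p.1 * h p.2) (x * y) :=
  hf.mul hh (summable_mul_of_summable_norm hf.summable.norm hh.summable.norm)

/-- The expansion of the integrand into products of beta kernels. -/
lemma hasSum_integrand (hg : HasEntireSeries g b) (w : ℂ) (t u : ℝ) :
    HasSum (fun p : ℕ × ℕ => 1 / ((p.1.factorial : ℂ) * (p.1.factorial : ℂ)) * b p.2
        * w ^ (p.1 + p.2) * (betaKernel (((j : ℝ) + ν) / 2 - 1 / 4) p.2 p.1 t
          * betaKernel (((j : ℝ) + ν) / 2) p.2 p.1 u))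
      (integrand ν j g w t u) := by
  have h1 : HasSum (fun l : ℕ => 1 / ((l.factorial : ℂ) * (l.factorial : ℂ))
      * (w * (1 - (t : ℂ)) * (1 - (u : ℂ))) ^ l)
      (besselI0 (2 * (w * (1 - (t : ℂ)) * (1 - (u : ℂ))) ^ (1 / 2 : ℂ))) :=
    hasEntireSeries_besselI0 (w * (1 - (t : ℂ)) * (1 - (u : ℂ)))
  have h2 : HasSum (fun i : ℕ => b i * (w * t * u) ^ i) (g (w * t * u)) := hg (w * t * u)
  have h3 := hasSum_mul_prod h1 h2
  have e1 : ((j : ℝ) + ν) / 2 - 1 / 4 - 1 = -(5 / 4 : ℝ) + ((j : ℝ) + ν) / 2 := by ring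
  have e2 : ((j : ℝ) + ν) / 2 - 1 = -(1 : ℝ) + ((j : ℝ) + ν) / 2 := by ring
  simp only [integrand, betaKernel, e1, e2]
  generalize ((t ^ (-(5 / 4 : ℝ) + ((j : ℝ) + ν) / 2) : ℝ) : ℂ) = A
  generalize ((u ^ (-(1 : ℝ) + ((j : ℝ) + ν) / 2) : ℝ) : ℂ) = B
  generalize besselI0 _ = C at h3 ⊢
  generalize g _ = G at h3 ⊢
  have h4 := h3.mul_left (A * B)
  rw [← mul_assoc] at h4
  have hterm : (fun p : ℕ × ℕ => A * B * (1 / ((p.1.factorial : ℂ) * (p.1.factorial : ℂ))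
      * (w * (1 - (t : ℂ)) * (1 - (u : ℂ))) ^ p.1 * (b p.2 * (w * t * u) ^ p.2)))
      = fun p : ℕ × ℕ => 1 / ((p.1.factorial : ℂ) * (p.1.factorial : ℂ)) * b p.2
        * w ^ (p.1 + p.2) * (A * ((t : ℂ) ^ p.2 * (1 - (t : ℂ)) ^ p.1)
          * (B * ((u : ℂ) ^ p.2 * (1 - (u : ℂ)) ^ p.1))) := by
    funext p
    simp only [mul_pow, pow_add]
    ring
  rw [hterm] at h4
  exact h4

lemma hasEntireSeries_integral (hj : 1 / 4 < ((j : ℝ) + ν) / 2) (hg : HasEntireSeries g b) :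
    HasEntireSeries
      (fun w => ∫ t in (0 : ℝ)..1, ∫ u in (0 : ℝ)..1, integrand ν j g w t u)
      (layerCoeff (fun i => ((i : ℂ) + ((j : ℂ) + ν) / 2 - 1 / 4) * ((i : ℂ) + ((j : ℂ) + ν) / 2))
        b) := by
  intro w
  have hs1 : 0 < ((j : ℝ) + ν) / 2 - 1 / 4 := by linarith
  have hs2 : 0 < ((j : ℝ) + ν) / 2 := by linarith
  have hint : ∀ p : ℕ × ℕ, Integrable (fun x : ℝ × ℝ =>
      1 / ((p.1.factorial : ℂ) * (p.1.factorial : ℂ)) * b p.2 * w ^ (p.1 + p.2)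
        * (betaKernel (((j : ℝ) + ν) / 2 - 1 / 4) p.2 p.1 x.1
          * betaKernel (((j : ℝ) + ν) / 2) p.2 p.1 x.2))
      ((volume.restrict (Set.Ioo (0 : ℝ) 1)).prod (volume.restrict (Set.Ioo (0 : ℝ) 1))) :=
    fun p => ((integrableOn_betaKernel hs1 p.2 p.1).mul_prod
      (integrableOn_betaKernel hs2 p.2 p.1)).const_mul _
  have hsum : Summable fun p : ℕ × ℕ => ∫ x : ℝ × ℝ,
      ‖1 / ((p.1.factorial : ℂ) * (p.1.factorial : ℂ)) * b p.2 * w ^ (p.1 + p.2)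
        * (betaKernel (((j : ℝ) + ν) / 2 - 1 / 4) p.2 p.1 x.1
          * betaKernel (((j : ℝ) + ν) / 2) p.2 p.1 x.2)‖
      ∂((volume.restrict (Set.Ioo (0 : ℝ) 1)).prod (volume.restrict (Set.Ioo (0 : ℝ) 1))) := by
    -- Each beta kernel has `L¹` norm at most that of its bare power, uniformly in the indices, so
    -- the coefficients alone ensure convergence.
    have hp := (summable_mul_of_summable_norm (hasEntireSeries_besselI0 w).summable.norm
      (hg w).summable.norm).norm.mul_right
        ((∫ t in Set.Ioo (0 : ℝ) 1, t ^ (((j : ℝ) + ν) / 2 - 1 / 4 - 1))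
          * ∫ t in Set.Ioo (0 : ℝ) 1, t ^ (((j : ℝ) + ν) / 2 - 1))
    refine Summable.of_nonneg_of_le (fun p => integral_nonneg fun x => norm_nonneg _) (fun p => ?_)
      hp
    simp only [norm_mul _ (betaKernel _ _ _ _ * betaKernel _ _ _ _), integral_const_mul]
    rw [show 1 / ((p.1.factorial : ℂ) * (p.1.factorial : ℂ)) * b p.2 * w ^ (p.1 + p.2)
      = 1 / ((p.1.factorial : ℂ) * (p.1.factorial : ℂ)) * w ^ p.1 * (b p.2 * w ^ p.2) by ring]
    refine mul_le_mul_of_nonneg_left ?_ (norm_nonneg _)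
    simp only [norm_mul (betaKernel _ _ _ _)]
    rw [integral_prod_mul (fun t => ‖betaKernel (((j : ℝ) + ν) / 2 - 1 / 4) p.2 p.1 t‖)
      (fun u => ‖betaKernel (((j : ℝ) + ν) / 2) p.2 p.1 u‖)]
    exact mul_le_mul (integral_norm_betaKernel_le hs1 _ _) (integral_norm_betaKernel_le hs2 _ _)
      (integral_nonneg fun _ => norm_nonneg _)
      ((integral_nonneg fun _ => norm_nonneg _).trans (integral_norm_betaKernel_le hs1 p.2 p.1))
  have hval : ∀ p : ℕ × ℕ, ∫ x : ℝ × ℝ,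
      1 / ((p.1.factorial : ℂ) * (p.1.factorial : ℂ)) * b p.2 * w ^ (p.1 + p.2)
        * (betaKernel (((j : ℝ) + ν) / 2 - 1 / 4) p.2 p.1 x.1
          * betaKernel (((j : ℝ) + ν) / 2) p.2 p.1 x.2)
      ∂((volume.restrict (Set.Ioo (0 : ℝ) 1)).prod (volume.restrict (Set.Ioo (0 : ℝ) 1)))
      = b p.2 / (∏ k ∈ Finset.range (p.1 + 1), (((p.2 + k : ℕ) : ℂ) + ((j : ℂ) + ν) / 2 - 1 / 4)
        * (((p.2 + k : ℕ) : ℂ) + ((j : ℂ) + ν) / 2)) * w ^ (p.1 + p.2) := by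
    intro p
    rw [integral_const_mul, integral_prod_mul, integral_betaKernel hs1, integral_betaKernel hs2,
      Finset.prod_mul_distrib]
    have hf : (p.1.factorial : ℂ) ≠ 0 := by exact_mod_cast p.1.factorial_ne_zero
    have e1 : ∏ k ∈ Finset.range (p.1 + 1),
        ((((j : ℝ) + ν) / 2 - 1 / 4 : ℝ) + ((p.2 + k : ℕ) : ℂ))
        = ∏ k ∈ Finset.range (p.1 + 1), (((p.2 + k : ℕ) : ℂ) + ((j : ℂ) + ν) / 2 - 1 / 4) :=
      Finset.prod_congr rfl fun k _ => by push_cast; ring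
    have e2 : ∏ k ∈ Finset.range (p.1 + 1), ((((j : ℝ) + ν) / 2 : ℝ) + ((p.2 + k : ℕ) : ℂ))
        = ∏ k ∈ Finset.range (p.1 + 1), (((p.2 + k : ℕ) : ℂ) + ((j : ℂ) + ν) / 2) :=
      Finset.prod_congr rfl fun k _ => by push_cast; ring
    rw [e1, e2]
    generalize ∏ k ∈ Finset.range (p.1 + 1), (((p.2 + k : ℕ) : ℂ) + ((j : ℂ) + ν) / 2 - 1 / 4) = A
    generalize ∏ k ∈ Finset.range (p.1 + 1), (((p.2 + k : ℕ) : ℂ) + ((j : ℂ) + ν) / 2) = B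
    simp only [div_eq_mul_inv, mul_inv, one_mul]
    field_simp
  have H := hasSum_integral_of_summable_integral_norm hint hsum
  simp only [(hasSum_integrand hg w _ _).tsum_eq, hval] at H
  rw [Measure.prod_restrict] at H
  show HasSum _ (∫ t in (0 : ℝ)..1, ∫ u in (0 : ℝ)..1, integrand ν j g w t u)
  rw [iteratedIntegral_eq_setIntegral_prod hj hg.differentiable w]
  -- Regroup the double series by the total power of `w`.
  have H' := (Finset.HasAntidiagonal.sigmaAntidiagonalEquivProd.hasSum_iff.2 H).sigma
    (fun i => hasSum_fintype _)
  convert! H' using 2 with i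
  rw [layerCoeff, Finset.sum_mul, ← Finset.sum_coe_sort (Finset.HasAntidiagonal.antidiagonal i)]
  refine Finset.sum_congr rfl fun p _ => ?_
  have hp := Finset.HasAntidiagonal.mem_antidiagonal.1 p.2
  simp only [Function.comp_apply, Finset.HasAntidiagonal.sigmaAntidiagonalEquivProd_apply, hp]

end Layer

/-! ### Recurrences and growth of the nested coefficients -/

/-- One sixteenth of the coefficient of `c_m` in the recurrence obtained from the power
`x^{m-1+ν}` in the algebraic Mathieu equation. -/
noncomputable def divisor (ν : ℝ) (m : ℕ) : ℂ :=
  ((m : ℂ) + ν) / 2 * (((m : ℂ) + ν) / 2 - 1 / 4)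

/-- One sixteenth of the coefficient of `c_m` in the recurrence obtained from the power
`x^{m+ν}` in the algebraic Mathieu equation, with sign reversed. -/
noncomputable def multiplier (lam q : ℂ) (ν : ℝ) (m : ℕ) : ℂ :=
  (((m : ℂ) + ν) / 2) ^ 2 - (lam + 2 * q) / 16

/-- The Taylor coefficients of the nested integrals. -/
noncomputable def nestedCoeff (lam q : ℂ) (ν : ℝ) : ℕ → ℕ → ℂ
  | 0 => fun i => 1 / ((ascPochhammer ℂ i).eval (1 + (ν : ℂ) / 2)
    * (ascPochhammer ℂ i).eval (3 / 4 + (ν : ℂ) / 2))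
  | n + 1 => layerCoeff (fun i => divisor ν (n + 1 + 2 * i))
      (fun i => multiplier lam q ν (n + 2 * i) * nestedCoeff lam q ν n i)

section

variable {lam q : ℂ} {ν : ℝ}

/-- With `a = (m + ν)/2` the divisor is `(a + 1/2)(a + 1/4)`. -/
lemma le_norm_divisor (hν : 0 ≤ ν) (m : ℕ) :
    (((m : ℝ) + ν) / 2) ^ 2 ≤ ‖divisor ν (m + 1)‖ := by
  have : divisor ν (m + 1)
      = (((((m : ℝ) + 1) + ν) / 2 * ((((m : ℝ) + 1) + ν) / 2 - 1 / 4) : ℝ) : ℂ) := by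
    rw [divisor]; push_cast; ring
  rw [this, Complex.norm_real]
  refine le_trans ?_ (Real.le_norm_self _)
  have hm : (0 : ℝ) ≤ m := m.cast_nonneg
  nlinarith

lemma divisor_ne_zero (hν : 0 ≤ ν) (m : ℕ) : divisor ν (m + 1) ≠ 0 := by
  have : divisor ν (m + 1)
      = (((((m : ℝ) + 1) + ν) / 2 * ((((m : ℝ) + 1) + ν) / 2 - 1 / 4) : ℝ) : ℂ) := by
    rw [divisor]; push_cast; ring
  rw [this, Complex.ofReal_ne_zero]
  have hm : (0 : ℝ) ≤ m := m.cast_nonneg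
  have h1 : 0 < (((m : ℝ) + 1) + ν) / 2 := by linarith
  have h2 : 0 < (((m : ℝ) + 1) + ν) / 2 - 1 / 4 := by linarith
  exact (mul_pos h1 h2).ne'

lemma norm_multiplier_le (m : ℕ) :
    ‖multiplier lam q ν m‖ ≤ (((m : ℝ) + ν) / 2) ^ 2 + ‖(lam + 2 * q) / 16‖ := by
  refine (norm_sub_le _ _).trans (add_le_add_left (le_of_eq ?_) _)
  rw [show (((m : ℂ) + ν) / 2) ^ 2 = (((((m : ℝ) + ν) / 2) ^ 2 : ℝ) : ℂ) by push_cast; ring,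
    Complex.norm_of_nonneg (by positivity)]

/-- The divisors eventually dominate. -/
lemma eventually_norm_multiplier_add_le (hν : 0 ≤ ν) {s t : ℝ} (hs : 1 < s) :
    ∀ᶠ m : ℕ in Filter.atTop,
      ‖multiplier lam q ν m‖ / s + 1 / t ≤ ‖divisor ν (m + 1)‖ := by
  have hX : Filter.Tendsto (fun m : ℕ => (((m : ℝ) + ν) / 2) ^ 2) Filter.atTop Filter.atTop :=
    (Filter.tendsto_pow_atTop two_ne_zero).comp
      ((Filter.tendsto_atTop_add_const_right _ ν tendsto_natCast_atTop_atTop).atTop_div_const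
        two_pos)
  have hs' : 0 < 1 - 1 / s := by
    rw [sub_pos, div_lt_one (by linarith)]; exact hs
  -- With `X = ((m + ν)/2)^2`, the claim follows from `(X + C)/s + 1/t ≤ X`, where `C` is the norm
  -- of the constant in the multiplier; this threshold solves it for `X`.
  filter_upwards [hX.eventually_ge_atTop ((‖(lam + 2 * q) / 16‖ / s + 1 / t) / (1 - 1 / s))]
    with m hm
  rw [div_le_iff₀ hs'] at hm
  have h1 : ‖multiplier lam q ν m‖ / s
      ≤ ((((m : ℝ) + ν) / 2) ^ 2 + ‖(lam + 2 * q) / 16‖) / s := by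
    gcongr
    exact norm_multiplier_le m
  rw [add_div] at h1
  have h2 := le_norm_divisor hν m
  have h3 : (((m : ℝ) + ν) / 2) ^ 2 * (1 - 1 / s)
    = (((m : ℝ) + ν) / 2) ^ 2 - (((m : ℝ) + ν) / 2) ^ 2 / s := by ring
  linarith

lemma nestedCoeff_zero_zero : nestedCoeff lam q ν 0 0 = 1 := by
  simp [nestedCoeff]

lemma divisor_mul_nestedCoeff_zero_succ (hν : 0 ≤ ν) (i : ℕ) :
    divisor ν (2 * i + 2) * nestedCoeff lam q ν 0 (i + 1) = nestedCoeff lam q ν 0 i := by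
  have h := divisor_ne_zero hν (2 * i + 1)
  have e : divisor ν (2 * i + 2)
      = (1 + (ν : ℂ) / 2 + i) * (3 / 4 + (ν : ℂ) / 2 + i) := by
    rw [divisor]; push_cast; ring
  rw [show 2 * i + 1 + 1 = 2 * i + 2 by ring, e] at h
  rw [e]
  simp only [nestedCoeff, ascPochhammer_succ_eval]
  rw [mul_one_div, mul_mul_mul_comm, div_mul_cancel_right₀ h, one_div]

lemma divisor_mul_nestedCoeff_succ_zero (hν : 0 ≤ ν) (n : ℕ) :
    divisor ν (n + 1) * nestedCoeff lam q ν (n + 1) 0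
      = multiplier lam q ν n * nestedCoeff lam q ν n 0 := by
  simp only [nestedCoeff, layerCoeff_zero, mul_zero, add_zero]
  exact mul_div_cancel₀ _ (divisor_ne_zero hν n)

/-- The last step of a path is either short or long. -/
lemma divisor_mul_nestedCoeff_succ_succ (hν : 0 ≤ ν) (n i : ℕ) :
    divisor ν (n + 2 * (i + 1) + 1) * nestedCoeff lam q ν (n + 1) (i + 1)
      = multiplier lam q ν (n + 2 * (i + 1)) * nestedCoeff lam q ν n (i + 1)
        + nestedCoeff lam q ν (n + 1) i := by
  rw [nestedCoeff, layerCoeff_succ, show n + 1 + 2 * (i + 1) = n + 2 * (i + 1) + 1 by ring,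
    mul_div_cancel₀ _ (divisor_ne_zero hν _), add_comm]

/-- The coefficients of the nested integrals are dominated by geometric sequences. -/
lemma exists_norm_nestedCoeff_le (lam q : ℂ) (hν : 0 ≤ ν) {s t : ℝ} (hs : 1 < s) (ht : 0 < t) :
    ∃ K : ℝ, 0 ≤ K ∧ ∀ n i, ‖nestedCoeff lam q ν n i‖ ≤ K * s ^ n * t ^ i := by
  have hs0 : 0 < s := by linarith
  obtain ⟨M, hM⟩ := Filter.eventually_atTop.1
    (eventually_norm_multiplier_add_le (lam := lam) (q := q) (t := t) hν hs)
  -- `K` absorbs the finitely many pairs with `n + 2i ≤ M`, where the divisors need not yet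
  -- dominate.
  set K : ℝ := ∑ p ∈ Finset.range (M + 1) ×ˢ Finset.range (M + 1),
    ‖nestedCoeff lam q ν p.1 p.2‖ / (s ^ p.1 * t ^ p.2) with hK
  have hK0 : 0 ≤ K := Finset.sum_nonneg fun p _ => by positivity
  have hsmall : ∀ n i, n + 2 * i ≤ M → ‖nestedCoeff lam q ν n i‖ ≤ K * s ^ n * t ^ i := by
    intro n i h
    have := Finset.single_le_sum
      (f := fun p : ℕ × ℕ => ‖nestedCoeff lam q ν p.1 p.2‖ / (s ^ p.1 * t ^ p.2))
      (fun p _ => by positivity)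
      (show (n, i) ∈ Finset.range (M + 1) ×ˢ Finset.range (M + 1) by
        simp only [Finset.mem_product, Finset.mem_range]; omega)
    rw [mul_assoc]
    exact (div_le_iff₀ (by positivity)).1 this
  -- A short predecessor carries the bound `L / s` and a long one `L / t`, so past `M` the
  -- recurrence reproduces the bound `L`.
  have hstep : ∀ (m : ℕ) (z X Y L : ℝ), M ≤ m → ‖divisor ν (m + 1)‖ * z
      ≤ ‖multiplier lam q ν m‖ * X + Y → X ≤ L / s → Y ≤ L / t → 0 ≤ L → z ≤ L := by
    intro m z X Y L hm h hX hY hL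
    have hD : 0 < ‖divisor ν (m + 1)‖ := norm_pos_iff.2 (divisor_ne_zero hν m)
    refine le_of_mul_le_mul_left (h.trans ?_) hD
    calc ‖multiplier lam q ν m‖ * X + Y ≤ ‖multiplier lam q ν m‖ * (L / s) + L / t := by gcongr
      _ = (‖multiplier lam q ν m‖ / s + 1 / t) * L := by ring
      _ ≤ _ := by gcongr; exact hM m hm
  refine ⟨K, hK0, fun n => ?_⟩
  induction n with
  | zero =>
    intro i
    induction i with
    | zero => exact hsmall 0 0 (by simp)
    | succ i ih =>
      rcases le_or_gt (0 + 2 * (i + 1)) M with h | h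
      · exact hsmall _ _ h
      · refine hstep (2 * i + 1) _ 0 ‖nestedCoeff lam q ν 0 i‖ _ (by omega) ?_ (by positivity) ?_
          (by positivity)
        · rw [← norm_mul, divisor_mul_nestedCoeff_zero_succ hν, mul_zero, zero_add]
        · rw [pow_succ, ← mul_assoc, mul_div_cancel_right₀ _ ht.ne']
          exact ih
  | succ n ihn =>
    intro i
    induction i with
    | zero =>
      rcases le_or_gt (n + 1 + 2 * 0) M with h | h
      · exact hsmall _ _ h
      · refine hstep n _ ‖nestedCoeff lam q ν n 0‖ 0 _ (by omega) ?_ ?_ (by positivity)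
          (by positivity)
        · rw [← norm_mul, divisor_mul_nestedCoeff_succ_zero hν, norm_mul, add_zero]
        · refine (ihn 0).trans (le_of_eq ?_)
          rw [eq_div_iff (by positivity)]
          ring
    | succ i ih =>
      rcases le_or_gt (n + 1 + 2 * (i + 1)) M with h | h
      · exact hsmall _ _ h
      · refine hstep (n + 2 * (i + 1)) _ ‖nestedCoeff lam q ν n (i + 1)‖
          ‖nestedCoeff lam q ν (n + 1) i‖ _ (by omega) ?_ ?_ ?_ (by positivity)
        · rw [← norm_mul, divisor_mul_nestedCoeff_succ_succ hν, ← norm_mul]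
          exact norm_add_le _ _
        · refine (ihn (i + 1)).trans (le_of_eq ?_)
          rw [eq_div_iff (by positivity)]
          ring
        · refine ih.trans (le_of_eq ?_)
          rw [eq_div_iff (by positivity)]
          ring

/-- The base series has infinite radius of convergence. -/
lemma hasEntireSeries_baseSeries (hν : 0 ≤ ν) :
    HasEntireSeries (baseSeries ν) (nestedCoeff lam q ν 0) := by
  intro w
  refine Summable.hasSum (f := baseTerm ν w) ?_
  -- The value of `s` is immaterial for `n = 0`; `t` is chosen so that `t (‖w‖ + 1) = 1/2`.
  obtain ⟨K, hK, h⟩ := exists_norm_nestedCoeff_le lam q hν one_lt_two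
    (by positivity : 0 < 1 / (2 * (‖w‖ + 1)))
  refine Summable.of_norm_bounded (summable_geometric_two.mul_left K) fun i => ?_
  have hi := h 0 i
  rw [pow_zero, mul_one] at hi
  have e : baseTerm ν w i = nestedCoeff lam q ν 0 i * w ^ i := rfl
  rw [e, norm_mul, norm_pow]
  calc ‖nestedCoeff lam q ν 0 i‖ * ‖w‖ ^ i
      ≤ K * (1 / (2 * (‖w‖ + 1))) ^ i * (‖w‖ + 1) ^ i := by gcongr; linarith
    _ = K * (1 / 2) ^ i := by
      rw [mul_assoc, ← mul_pow]
      congr 2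
      field_simp

/-- On `w^i` the operator and the integral of a layer see only `i + (n + ν)/2` and `i + (n + 1 +
ν)/2`, that is, the positions `n + 2i` and `n + 1 + 2i` on the path. -/
lemma hasEntireSeries_nested (hν : 0 ≤ ν) (n : ℕ) :
    HasEntireSeries (nested lam q ν n) (nestedCoeff lam q ν n) := by
  induction n with
  | zero => exact hasEntireSeries_baseSeries hν
  | succ n ih =>
    have hn : (0 : ℝ) ≤ n := n.cast_nonneg
    have h := hasEntireSeries_integral (ν := ν) (j := n + 1) (by push_cast; linarith)
      (ih.mathieuOp lam q (((n : ℝ) + ν) / 2))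
    have e1 : (fun i : ℕ => ((i : ℂ) + (((n + 1 : ℕ) : ℂ) + ν) / 2 - 1 / 4)
        * ((i : ℂ) + (((n + 1 : ℕ) : ℂ) + ν) / 2)) = fun i => divisor ν (n + 1 + 2 * i) := by
      funext i; rw [divisor]; push_cast; ring
    have e2 : (fun i : ℕ => (((i : ℂ) + ((((n : ℝ) + ν) / 2 : ℝ) : ℂ)) ^ 2 - (lam + 2 * q) / 16)
        * nestedCoeff lam q ν n i)
        = fun i => multiplier lam q ν (n + 2 * i) * nestedCoeff lam q ν n i := by
      funext i; rw [multiplier]; push_cast; ring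
    rw [e1, e2] at h
    exact h

/-! ### Path sums and rearrangement of the double series -/

/-- The contribution of `i` long steps to the coefficient of `x^m`. -/
noncomputable def pathCoeff (lam q : ℂ) (ν : ℝ) (m i : ℕ) : ℂ :=
  if 2 * i ≤ m then nestedCoeff lam q ν (m - 2 * i) i * (q / 4) ^ i else 0

lemma pathCoeff_add (n i : ℕ) :
    pathCoeff lam q ν (n + 2 * i) i = nestedCoeff lam q ν n i * (q / 4) ^ i := by
  rw [pathCoeff, if_pos (by omega), Nat.add_sub_cancel]

lemma pathCoeff_of_lt {m i : ℕ} (h : m < 2 * i) : pathCoeff lam q ν m i = 0 :=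
  if_neg (by omega)

lemma divisor_mul_pathCoeff_zero (hν : 0 ≤ ν) (m : ℕ) :
    divisor ν (m + 1) * pathCoeff lam q ν (m + 1) 0
      = multiplier lam q ν m * pathCoeff lam q ν m 0 := by
  simpa [pathCoeff] using divisor_mul_nestedCoeff_succ_zero hν m

lemma divisor_mul_pathCoeff_succ (hν : 0 ≤ ν) (m i : ℕ) :
    divisor ν (m + 2) * pathCoeff lam q ν (m + 2) (i + 1)
      = multiplier lam q ν (m + 1) * pathCoeff lam q ν (m + 1) (i + 1)
        + q / 4 * pathCoeff lam q ν m i := by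
  -- Either no path exists, or all steps are long (base series recurrence), or at least one step is
  -- short.
  rcases lt_trichotomy m (2 * i) with h | rfl | h
  · rw [pathCoeff_of_lt h, pathCoeff_of_lt (by omega), pathCoeff_of_lt (by omega)]
    simp
  · have h1 := pathCoeff_add (lam := lam) (q := q) (ν := ν) 0 (i + 1)
    have h2 := pathCoeff_add (lam := lam) (q := q) (ν := ν) 0 i
    rw [show 0 + 2 * (i + 1) = 2 * i + 2 by ring] at h1
    rw [zero_add] at h2
    rw [h1, h2, pathCoeff_of_lt (by omega), ← divisor_mul_nestedCoeff_zero_succ hν i]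
    ring
  · obtain ⟨n, rfl⟩ : ∃ n, m = n + 1 + 2 * i := ⟨m - 2 * i - 1, by omega⟩
    have h1 := pathCoeff_add (lam := lam) (q := q) (ν := ν) (n + 1) (i + 1)
    have h2 := pathCoeff_add (lam := lam) (q := q) (ν := ν) n (i + 1)
    have h3 := divisor_mul_nestedCoeff_succ_succ (lam := lam) (q := q) hν n i
    rw [show n + 1 + 2 * (i + 1) = n + 1 + 2 * i + 2 by ring] at h1
    rw [show n + 2 * (i + 1) = n + 1 + 2 * i + 1 by ring] at h2 h3
    rw [h1, h2, pathCoeff_add, ← mul_assoc, h3]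
    ring

/-- The coefficients of the normalised Frobenius solution. -/
noncomputable def frobeniusCoeff (lam q : ℂ) (ν : ℝ) (m : ℕ) : ℂ :=
  ∑ i ∈ Finset.range (m + 1), pathCoeff lam q ν m i

/-- Padding with zeros aligns the ranges, so that the path recurrences can be summed over `i`. -/
lemma frobeniusCoeff_eq_sum {m N : ℕ} (h : m + 1 ≤ N) :
    frobeniusCoeff lam q ν m = ∑ i ∈ Finset.range N, pathCoeff lam q ν m i :=
  Finset.sum_subset (Finset.range_mono h) fun i _ hi =>
    pathCoeff_of_lt (by rw [Finset.mem_range] at hi; omega)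

lemma frobeniusCoeff_zero : frobeniusCoeff lam q ν 0 = 1 := by
  simp [frobeniusCoeff, pathCoeff, nestedCoeff_zero_zero]

lemma divisor_mul_frobeniusCoeff_one (hν : 0 ≤ ν) :
    divisor ν 1 * frobeniusCoeff lam q ν 1
      = multiplier lam q ν 0 * frobeniusCoeff lam q ν 0 := by
  have h := divisor_mul_pathCoeff_zero (lam := lam) (q := q) hν 0
  rw [zero_add] at h
  rw [frobeniusCoeff, frobeniusCoeff, zero_add, Finset.sum_range_succ,
    Finset.sum_range_one, Finset.sum_range_one, pathCoeff_of_lt (m := 1) (i := 1) (by norm_num),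
    add_zero, h]

lemma divisor_mul_frobeniusCoeff_add_two (hν : 0 ≤ ν) (m : ℕ) :
    divisor ν (m + 2) * frobeniusCoeff lam q ν (m + 2)
      = multiplier lam q ν (m + 1) * frobeniusCoeff lam q ν (m + 1)
        + q / 4 * frobeniusCoeff lam q ν m := by
  rw [frobeniusCoeff_eq_sum (N := m + 3) (by omega), frobeniusCoeff_eq_sum (N := m + 3) (by omega),
    frobeniusCoeff_eq_sum (N := m + 2) (by omega), Finset.sum_range_succ',
    Finset.sum_range_succ' (pathCoeff lam q ν (m + 1)), mul_add, mul_add,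
    divisor_mul_pathCoeff_zero hν, Finset.mul_sum, Finset.mul_sum,
    Finset.mul_sum, add_right_comm, ← Finset.sum_add_distrib]
  simp only [divisor_mul_pathCoeff_succ hν]

/-- The recurrence determines the coefficients up to the first one. -/
lemma eq_mul_frobeniusCoeff (hν : 0 ≤ ν) {c : ℕ → ℂ}
    (h1 : divisor ν 1 * c 1 = multiplier lam q ν 0 * c 0)
    (h2 : ∀ m, divisor ν (m + 2) * c (m + 2)
      = multiplier lam q ν (m + 1) * c (m + 1) + q / 4 * c m) (m : ℕ) :
    c m = c 0 * frobeniusCoeff lam q ν m := by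
  induction m using Nat.twoStepInduction with
  | zero => rw [frobeniusCoeff_zero, mul_one]
  | one =>
    refine mul_left_cancel₀ (divisor_ne_zero hν 0) ?_
    rw [zero_add, h1, mul_left_comm, divisor_mul_frobeniusCoeff_one hν, frobeniusCoeff_zero]
    ring
  | more m ih1 ih2 =>
    refine mul_left_cancel₀ (divisor_ne_zero hν (m + 1)) ?_
    rw [h2, mul_left_comm, divisor_mul_frobeniusCoeff_add_two hν, ih1, ih2]
    ring

lemma summable_nestedCoeff_mul (hν : 0 ≤ ν) {x : ℂ} (hx : ‖x‖ < 1) (η : ℂ) :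
    Summable fun p : ℕ × ℕ => nestedCoeff lam q ν p.1 p.2 * η ^ p.2 * x ^ p.1 := by
  obtain ⟨s, hs1, hs2⟩ : ∃ s : ℝ, 1 < s ∧ s * ‖x‖ < 1 := by
    -- Both inequalities are equivalent to `‖x‖ < 1`.
    refine ⟨2 / (1 + ‖x‖), ?_, ?_⟩
    · rw [lt_div_iff₀ (by positivity)]; linarith
    · rw [div_mul_eq_mul_div, div_lt_one (by positivity)]; linarith
  obtain ⟨K, hK, h⟩ := exists_norm_nestedCoeff_le lam q hν hs1
    (by positivity : 0 < 1 / (2 * (‖η‖ + 1)))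
  have hs0 : 0 ≤ s * ‖x‖ := by positivity
  refine Summable.of_norm_bounded (((summable_geometric_of_lt_one hs0 hs2).mul_of_nonneg
    summable_geometric_two (fun _ => by positivity) (fun _ => by positivity)).mul_left K)
    fun p => ?_
  rw [norm_mul, norm_mul, norm_pow, norm_pow]
  calc ‖nestedCoeff lam q ν p.1 p.2‖ * ‖η‖ ^ p.2 * ‖x‖ ^ p.1
      ≤ K * s ^ p.1 * (1 / (2 * (‖η‖ + 1))) ^ p.2 * (‖η‖ + 1) ^ p.2 * ‖x‖ ^ p.1 := by
        gcongr
        · exact h p.1 p.2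
        · linarith
    _ = K * ((s * ‖x‖) ^ p.1 * (1 / (2 * (‖η‖ + 1)) * (‖η‖ + 1)) ^ p.2) := by
      rw [mul_pow, mul_pow]; ring
    _ = K * ((s * ‖x‖) ^ p.1 * (1 / 2) ^ p.2) := by
      congr 3
      field_simp

/-- The two ways of summing the double series. -/
lemma exists_hasSum_nested_frobeniusCoeff (hν : 0 ≤ ν) {x : ℂ} (hx : ‖x‖ < 1) :
    ∃ T : ℂ, HasSum (fun n => nested lam q ν n (q / 4 * x ^ 2) * x ^ n) T ∧
      HasSum (fun m => frobeniusCoeff lam q ν m * x ^ m) T := by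
  obtain ⟨T, hT⟩ := summable_nestedCoeff_mul (lam := lam) (q := q) hν hx (q / 4 * x ^ 2)
  have hfib : ∀ n, HasSum (fun i => nestedCoeff lam q ν n i * (q / 4 * x ^ 2) ^ i * x ^ n)
      (nested lam q ν n (q / 4 * x ^ 2) * x ^ n) := fun n =>
    HasSum.mul_right (x ^ n) (hasEntireSeries_nested hν n (q / 4 * x ^ 2))
  refine ⟨T, hT.prod_fiberwise hfib, ?_⟩
  -- Reindex by the endpoint `m = n + 2i`; off the image `m < 2i`, where the path coefficient
  -- vanishes.
  have hinj : Function.Injective fun p : ℕ × ℕ => (p.1 + 2 * p.2, p.2) := by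
    rintro ⟨a, b⟩ ⟨a', b'⟩ h
    simp only [Prod.mk.injEq] at h ⊢
    omega
  have hG : HasSum (fun p : ℕ × ℕ => pathCoeff lam q ν p.1 p.2 * x ^ p.1) T := by
    refine (hinj.hasSum_iff ?_).1 ?_
    · rintro ⟨m, i⟩ h
      rw [pathCoeff_of_lt, zero_mul]
      by_contra hlt
      exact h ⟨(m - 2 * i, i), Prod.ext (by dsimp only at hlt ⊢; omega) rfl⟩
    · convert! hT using 2 with p
      simp only [Function.comp_apply]
      rw [pathCoeff_add, mul_pow, pow_add, pow_mul]
      ring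
  have hfib' : ∀ m, HasSum (fun i => pathCoeff lam q ν m i * x ^ m)
      (frobeniusCoeff lam q ν m * x ^ m) := fun m =>
    HasSum.mul_right (x ^ m) (hasSum_sum_of_ne_finset_zero fun i hi =>
      pathCoeff_of_lt (by rw [Finset.mem_range] at hi; omega))
  exact hG.prod_fiberwise hfib'

end

/-! ### From the differential equation to the recurrence -/

section PowerSeries

/-- A power series vanishing on an interval `(0, r)` has vanishing constant term. -/
lemma coeff_zero_eq_zero_of_hasSum_zero {e : ℕ → ℂ} {r : ℝ} (hr : 0 < r)
    (h : ∀ x ∈ Set.Ioo (0 : ℝ) r, HasSum (fun n => e n * (x : ℂ) ^ n) 0) : e 0 = 0 := by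
  have hs : Summable fun n => ‖e n‖ * (r / 2) ^ n := by
    have := (h (r / 2) ⟨by linarith, by linarith⟩).summable.norm
    simpa only [norm_mul, norm_pow, Complex.norm_of_nonneg (half_pos hr).le] using this
  -- The hypothesis says nothing at `0`, so the constant term is reached as a one-sided limit.
  have hc : ContinuousOn (fun x : ℝ => ∑' n, e n * (x : ℂ) ^ n) (Set.Icc 0 (r / 2)) := by
    refine continuousOn_tsum (fun n => by fun_prop) hs fun n x hx => ?_
    rw [norm_mul, norm_pow, Complex.norm_of_nonneg hx.1]
    have := hx.1
    gcongr
    exact hx.2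
  have h0 : (∑' n, e n * ((0 : ℝ) : ℂ) ^ n) = e 0 := by
    rw [tsum_eq_single 0 (fun n hn => by simp [hn])]
    simp
  have ht : Filter.Tendsto (fun x : ℝ => ∑' n, e n * (x : ℂ) ^ n)
      (nhdsWithin 0 (Set.Ioo 0 (r / 2))) (nhds (e 0)) := by
    have := (hc 0 ⟨le_rfl, by linarith⟩).mono Set.Ioo_subset_Icc_self
    rw [ContinuousWithinAt, h0] at this
    exact this
  have hz : Filter.Tendsto (fun x : ℝ => ∑' n, e n * (x : ℂ) ^ n)
      (nhdsWithin 0 (Set.Ioo 0 (r / 2))) (nhds 0) := by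
    refine tendsto_const_nhds.congr' ?_
    filter_upwards [self_mem_nhdsWithin] with x hx
    exact (h x ⟨hx.1, by linarith [hx.2]⟩).tsum_eq.symm
  have : (nhdsWithin (0 : ℝ) (Set.Ioo 0 (r / 2))).NeBot := by
    rw [nhdsWithin_Ioo_eq_nhdsGT (half_pos hr)]
    infer_instance
  exact tendsto_nhds_unique ht hz

/-- A power series vanishing on an interval `(0, r)` has vanishing coefficients. -/
lemma coeff_eq_zero_of_hasSum_zero {r : ℝ} (hr : 0 < r) (n : ℕ) :
    ∀ {e : ℕ → ℂ}, (∀ x ∈ Set.Ioo (0 : ℝ) r, HasSum (fun n => e n * (x : ℂ) ^ n) 0) →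
      e n = 0 := by
  induction n with
  | zero => exact fun h => coeff_zero_eq_zero_of_hasSum_zero hr h
  | succ n ih =>
    intro e h
    refine ih (e := fun n => e (n + 1)) fun x hx => ?_
    have h0 := coeff_zero_eq_zero_of_hasSum_zero hr h
    have h1 := (hasSum_nat_add_iff' 1).2 (h x hx)
    simp only [Finset.sum_range_one, h0, zero_mul, sub_zero] at h1
    have hx0 : (x : ℂ) ≠ 0 := by exact_mod_cast hx.1.ne'
    have h2 := h1.mul_right (x : ℂ)⁻¹
    rw [zero_mul] at h2
    convert! h2 using 2 with n
    rw [pow_succ]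
    field_simp

lemma summable_norm_coeff_mul_pow {c : ℕ → ℂ} {μ ρ : ℝ} (hρ : 0 < ρ)
    (h : Summable (frobeniusTerm μ c ρ)) : Summable fun n => ‖c n‖ * ρ ^ n := by
  have h' := h.norm.mul_right ((ρ ^ μ)⁻¹)
  have hμ : ρ ^ μ ≠ 0 := (Real.rpow_pos_of_pos hρ μ).ne'
  refine h'.congr fun n => ?_
  rw [frobeniusTerm, norm_mul, Complex.norm_cpow_eq_rpow_re_of_pos hρ, Complex.add_re,
    Complex.natCast_re, Complex.ofReal_re, Real.rpow_add hρ, Real.rpow_natCast]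
  field_simp

/-- Termwise differentiation of a Frobenius series on the positive axis. -/
lemma hasSum_deriv_frobeniusSum {c : ℕ → ℂ} {μ r : ℝ}
    (h : ∀ x ∈ Set.Ioo (0 : ℝ) r, Summable (frobeniusTerm μ c x)) {x : ℝ}
    (hx : x ∈ Set.Ioo (0 : ℝ) r) :
    HasSum (frobeniusTerm (μ - 1) (fun n => ((n : ℂ) + μ) * c n) x)
      (deriv (fun s : ℝ => frobeniusSum μ c s) x) := by
  obtain ⟨ρ, hρ1, hρ2⟩ := exists_between hx.2
  have hρ : 0 < ρ := hx.1.trans hρ1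
  -- The exponent `μ` may be negative, so `y^μ` is bounded only away from `0`.
  obtain ⟨B, hB⟩ : ∃ B : ℝ, ∀ y ∈ Set.Icc (x / 2) ρ, ‖y ^ μ‖ ≤ B :=
    isCompact_Icc.exists_bound_of_continuousOn fun y hy =>
      (Real.continuousAt_rpow_const y μ
        (Or.inl (by linarith [hx.1, hy.1] : (0 : ℝ) < y).ne')).continuousWithinAt
  have hB0 : 0 ≤ B := (norm_nonneg _).trans (hB ρ ⟨by linarith, le_rfl⟩)
  -- On this complex neighbourhood of `x` principal powers are holomorphic, and a summable bound on
  -- the terms alone permits termwise differentiation.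
  set U : Set ℂ := {z | x / 2 < z.re} ∩ Metric.ball 0 ρ with hU
  have hUo : IsOpen U := (isOpen_lt continuous_const Complex.continuous_re).inter Metric.isOpen_ball
  have hUre : ∀ z ∈ U, 0 < z.re := fun z hz => (half_pos hx.1).trans hz.1
  have hxU : (x : ℂ) ∈ U := by
    refine ⟨?_, ?_⟩
    · show x / 2 < (x : ℂ).re
      rw [Complex.ofReal_re]; linarith [hx.1]
    · rw [mem_ball_zero_iff, Complex.norm_of_nonneg hx.1.le]; exact hρ1
  have hda : ∀ n : ℕ, ∀ z ∈ U, HasDerivAt (fun z => frobeniusTerm μ c z n)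
      (frobeniusTerm (μ - 1) (fun n => ((n : ℂ) + μ) * c n) z n) z := by
    intro n z hz
    have := ((hasDerivAt_id z).cpow_const (c := (n : ℂ) + μ) (Or.inl (hUre z hz))).const_mul (c n)
    refine this.congr_deriv ?_
    simp only [frobeniusTerm, id]
    push_cast
    rw [add_sub_assoc]
    ring
  have hsum := (summable_norm_coeff_mul_pow hρ (h ρ ⟨hρ, hρ2⟩)).mul_right B
  have hle : ∀ n : ℕ, ∀ z ∈ U, ‖frobeniusTerm μ c z n‖ ≤ ‖c n‖ * ρ ^ n * B := by
    intro n z hz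
    have hz0 : z ≠ 0 := fun h0 => by simpa [h0] using hUre z hz
    have hzρ : ‖z‖ < ρ := mem_ball_zero_iff.1 hz.2
    have hzx : x / 2 ≤ ‖z‖ := hz.1.le.trans (Complex.re_le_norm z)
    rw [frobeniusTerm, norm_mul, Complex.cpow_add _ _ hz0, norm_mul, Complex.cpow_natCast,
      norm_pow, Complex.norm_cpow_real, ← mul_assoc]
    gcongr
    exact (Real.le_norm_self _).trans (hB _ ⟨hzx, hzρ.le⟩)
  have hd : ∀ n : ℕ, DifferentiableOn ℂ (fun z => frobeniusTerm μ c z n) U :=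
    fun n z hz => (hda n z hz).differentiableAt.differentiableWithinAt
  have H := Complex.hasSum_deriv_of_summable_norm (F := fun n z => frobeniusTerm μ c z n)
    hsum hd hUo hle hxU
  have hdiff := (Complex.differentiableOn_tsum_of_summable_norm
    (F := fun n z => frobeniusTerm μ c z n) hsum hd hUo hle).differentiableAt (hUo.mem_nhds hxU)
  have hreal : deriv (fun s : ℝ => frobeniusSum μ c s) x
      = deriv (fun z : ℂ => ∑' n, frobeniusTerm μ c z n) x :=
    hdiff.hasDerivAt.comp_ofReal.deriv
  rw [hreal]
  convert! H using 2 with n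
  exact (hda n x hxU).deriv.symm

/-- Multiplication of a power series by its variable, on coefficients. -/
def shiftCoeff (a : ℕ → ℂ) : ℕ → ℂ
  | 0 => 0
  | n + 1 => a n

lemma hasSum_shiftCoeff {a : ℕ → ℂ} {x s : ℂ} (h : HasSum (fun n => a n * x ^ n) s) :
    HasSum (fun n => shiftCoeff a n * x ^ n) (x * s) := by
  refine (hasSum_nat_add_iff' 1).1 ?_
  simp only [Finset.sum_range_one, shiftCoeff, zero_mul, sub_zero]
  convert! h.mul_left x using 2 with n
  rw [pow_succ]
  ring

/-- Turns `x^k y^(k) / x^ν` into an ordinary power series, so that coefficients can be compared. -/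
lemma hasSum_of_hasSum_frobeniusTerm {a : ℕ → ℂ} {ν x : ℝ} (hx : 0 < x) {s : ℂ} (k : ℕ)
    (h : HasSum (frobeniusTerm (ν - k) a x) s) :
    HasSum (fun n => a n * (x : ℂ) ^ n) ((x : ℂ) ^ k * s / (x : ℂ) ^ (ν : ℂ)) := by
  have hx0 : (x : ℂ) ≠ 0 := by exact_mod_cast hx.ne'
  have hP : (x : ℂ) ^ (ν : ℂ) ≠ 0 := by simp [Complex.cpow_eq_zero_iff, hx0]
  convert! (h.mul_left ((x : ℂ) ^ k)).div_const ((x : ℂ) ^ (ν : ℂ)) using 2 with n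
  rw [frobeniusTerm, Complex.ofReal_sub, Complex.ofReal_natCast, Complex.cpow_add _ _ hx0,
    Complex.cpow_sub _ _ hx0, Complex.cpow_natCast, Complex.cpow_natCast]
  field_simp

/-- A Frobenius series that solves the equation satisfies the three-term recurrence. -/
lemma IsFrobeniusSolution.recurrence {lam q : ℂ} {ν : ℝ} {c : ℕ → ℂ}
    (h : IsFrobeniusSolution lam q ν c) :
    divisor ν 1 * c 1 = multiplier lam q ν 0 * c 0 ∧
      ∀ m, divisor ν (m + 2) * c (m + 2)
        = multiplier lam q ν (m + 1) * c (m + 1) + q / 4 * c m := by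
  obtain ⟨r, hr, h⟩ := h
  have hs : ∀ x ∈ Set.Ioo (0 : ℝ) r, Summable (frobeniusTerm ν c x) := fun x hx => (h x hx).1
  set c1 : ℕ → ℂ := fun n => ((n : ℂ) + ν) * c n with hc1
  -- This is the equation multiplied by `x` and divided by `x^ν`; each further factor `x` is a shift
  -- of coefficients.
  have key : ∀ x ∈ Set.Ioo (0 : ℝ) r, HasSum (fun n =>
      (16 * (divisor ν n * c n) - shiftCoeff (fun n => 16 * (multiplier lam q ν n * c n)) n
        - 4 * q * shiftCoeff (shiftCoeff c) n) * (x : ℂ) ^ n) 0 := by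
    intro x hx
    have hx0 : (x : ℂ) ≠ 0 := by exact_mod_cast hx.1.ne'
    have hP : (x : ℂ) ^ (ν : ℂ) ≠ 0 := by simp [Complex.cpow_eq_zero_iff, hx0]
    have h1 : ∀ y ∈ Set.Ioo (0 : ℝ) r, HasSum (frobeniusTerm (ν - 1) c1 y)
        (deriv (fun s : ℝ => frobeniusSum ν c s) y) := fun y hy => hasSum_deriv_frobeniusSum hs hy
    have h2 := hasSum_deriv_frobeniusSum (fun y hy => (h1 y hy).summable) hx
    have hev : deriv (fun s : ℝ => frobeniusSum ν c s)
        =ᶠ[nhds x] fun s : ℝ => frobeniusSum (ν - 1) c1 s := by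
      filter_upwards [isOpen_Ioo.mem_nhds hx] with y hy
      exact (h1 y hy).tsum_eq.symm
    rw [← hev.deriv_eq] at h2
    have hv0 := hasSum_of_hasSum_frobeniusTerm (ν := ν) hx.1 0 (by simpa using (hs x hx).hasSum)
    have hv1 := hasSum_of_hasSum_frobeniusTerm (ν := ν) hx.1 1 (by simpa using h1 x hx)
    have hv2 := hasSum_of_hasSum_frobeniusTerm (ν := ν) hx.1 2 (by
      rw [show ν - (2 : ℕ) = ν - 1 - 1 by push_cast; ring]
      exact h2)
    have hode := (h x hx).2
    rw [SatisfiesEquationAt] at hode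
    have hy : (∑' n, frobeniusTerm ν c x n) = frobeniusSum ν c x := rfl
    rw [hy] at hv0
    generalize deriv (deriv fun s : ℝ => frobeniusSum ν c s) x = y2 at hode hv2
    generalize deriv (fun s : ℝ => frobeniusSum ν c s) x = y1 at hode hv1
    generalize frobeniusSum ν c x = y0 at hode hv0
    have hA := (hv2.mul_left 4).add (hv1.mul_left 2)
    have hB := hasSum_shiftCoeff (x := (x : ℂ)) (a := fun n => 16 * (multiplier lam q ν n * c n))
      (by
        convert! ((hv2.mul_left 4).add (hv1.mul_left 4)).sub (hv0.mul_left (lam + 2 * q))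
          using 2 with n
        simp only [hc1, multiplier]
        push_cast
        ring)
    have hC := (hasSum_shiftCoeff (hasSum_shiftCoeff hv0)).mul_left (4 * q)
    convert! (hA.sub hB).sub hC using 2 with n
    · simp only [hc1, divisor]
      push_cast
      ring
    · field_simp
      linear_combination (-(x : ℂ)) * hode
  have he := fun n => coeff_eq_zero_of_hasSum_zero hr n key
  -- Degree `0` is the indicial equation; degrees `1` and `m + 2` give the recurrence.
  refine ⟨?_, fun m => ?_⟩
  · have := he 1
    simp only [shiftCoeff] at this
    linear_combination this / 16
  · have := he (m + 2)
    simp only [shiftCoeff] at this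
    linear_combination this / 16

end PowerSeries

end Mathieu

theorem mainTheorem1 (lam q : ℂ) (ν : ℝ) (hν : ν = 0 ∨ ν = 1 / 2) (c : ℕ → ℂ)
    (hy : Mathieu.IsFrobeniusSolution lam q ν c) :
    -- the base series converges everywhere
    (∀ w : ℂ, Summable (Mathieu.baseTerm ν w)) ∧
    -- every block to which an operator is applied is an entire function of its variable
    (∀ j : ℕ, Differentiable ℂ (Mathieu.nested lam q ν j)) ∧
    -- every double integral converges absolutely
    (∀ (j : ℕ) (w : ℂ), IntegrableOn
      (fun p : ℝ × ℝ => Mathieu.integrand ν (j + 1)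
        (Mathieu.mathieuOp lam q (((j : ℝ) + ν) / 2) (Mathieu.nested lam q ν j)) w p.1 p.2)
      (Set.Ioo (0 : ℝ) 1 ×ˢ Set.Ioo (0 : ℝ) 1)) ∧
    -- the integral representation
    ∀ x : ℂ, ‖x‖ < 1 → ∀ η : ℂ, η = 1 / 4 * q * x ^ 2 →
      Summable (Mathieu.frobeniusTerm ν c x) ∧
      Summable (fun n : ℕ => Mathieu.nested lam q ν (n + 1) η * x ^ (n + 1)) ∧
      Mathieu.frobeniusSum ν c x =
        c 0 * x ^ (ν : ℂ) * (Mathieu.baseSeries ν η +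
          ∑' n : ℕ, Mathieu.nested lam q ν (n + 1) η * x ^ (n + 1)) := by
  have hν0 : 0 ≤ ν := by rcases hν with rfl | rfl <;> norm_num
  refine ⟨fun w => (Mathieu.hasEntireSeries_baseSeries (lam := lam) (q := q) hν0 w).summable,
    fun j => (Mathieu.hasEntireSeries_nested hν0 j).differentiable, fun j w => ?_, ?_⟩
  · have hj : (0 : ℝ) ≤ j := j.cast_nonneg
    exact Mathieu.integrableOn_integrand (by push_cast; linarith)
      ((Mathieu.hasEntireSeries_nested hν0 j).mathieuOp lam q _).differentiable w
  · rintro x hx η rfl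
    rw [show 1 / 4 * q * x ^ 2 = q / 4 * x ^ 2 by ring]
    obtain ⟨T, hT, hF⟩ :=
      Mathieu.exists_hasSum_nested_frobeniusCoeff (lam := lam) (q := q) hν0 hx
    -- Split off the term `n = 0`, the base series.
    have hT' := (hasSum_nat_add_iff' 1).2 hT
    simp only [Finset.sum_range_one, pow_zero, mul_one] at hT'
    have hterm : ∀ n, Mathieu.frobeniusTerm ν c x n
        = c 0 * x ^ (ν : ℂ) * (Mathieu.frobeniusCoeff lam q ν n * x ^ n) := by
      intro n
      have hpow : x ^ ((n : ℂ) + (ν : ℂ)) = x ^ (ν : ℂ) * x ^ n := by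
        -- At `x = 0` the power law for `cpow` is not available; for `n > 0` both sides vanish
        -- because `n + ν ≠ 0`.
        rcases eq_or_ne x 0 with rfl | hx0
        · rcases Nat.eq_zero_or_pos n with rfl | hn
          · simp
          · have : (n : ℂ) + (ν : ℂ) ≠ 0 := by
              have : (0 : ℝ) < n + ν := by positivity
              exact_mod_cast this.ne'
            rw [Complex.zero_cpow this, zero_pow hn.ne', mul_zero]
        · rw [Complex.cpow_add _ _ hx0, Complex.cpow_natCast, mul_comm]
      rw [Mathieu.frobeniusTerm, hpow,
        Mathieu.eq_mul_frobeniusCoeff hν0 hy.recurrence.1 hy.recurrence.2 n]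
      ring
    have hS : HasSum (Mathieu.frobeniusTerm ν c x) (c 0 * x ^ (ν : ℂ) * T) := by
      rw [funext hterm]
      exact hF.mul_left _
    refine ⟨hS.summable, hT'.summable, ?_⟩
    rw [Mathieu.frobeniusSum, hS.tsum_eq, hT'.tsum_eq]
    simp only [Mathieu.nested, add_sub_cancel]
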